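/- Let $F$ be an algebraically closed field of characteristic $0$ and let $k\ge 2$. For an alternating bicharacter $\beta:G\times G\to F^\times$ of a finite abelian group $G$ (biadditive, $\beta(g,g)=1$), put $\mathrm{Rad}(\beta)=\{g\in G:\beta(g,h)=1\ \forall h\in G\}$; $\beta$ is nonsingular if $\mathrm{Rad}(\beta)=0$. A subset $R\subseteq G$ is a *skew root system of Lie type* in $(G,\beta)$ if $\mathrm{Rad}(\beta)\ne G$, $R\subseteq G\setminus\mathrm{Rad}(\beta)$, $R$ generates $G$, $R=-R$, and $a+b\in R$ whenever $a,b\in R$ and $\beta(a,b)\neq 1$. It is *reduced* if $\beta$ is nonsingular, and *decomposable* if $G$ is the orthogonal direct sum of two proper subgroups $G_1,G_2$ and $R=R_1\cup R_2$ with $R_1\perp R_2$ and each $R_i\subseteq G_i$ a skew root system of Lie type in $(G_i,\beta|_{G_i})$. The *corresponding reduced system* of $R$ is the image $\overline R$ of $R$ in $\overline G=G/\mathrm{Rad}(\beta)$ with the induced bicharacter $\overline\beta$. For a 2-cocycle $\xi\in Z^2(G,F^\times)$ with $\beta(a,b)=\xi(a,b)\xi(b,a)^{-1}$, let $F^\xi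 G$ be the twisted group algebra with basis $(u_a)_{a\in G}$ and $u_au_b=\xi(a,b)u_{a+b}$, and let $L(R)=\bigoplus_{a\in R}Fu_a$, a Lie subalgebra of $F^\xi G$ under the commutator. Let $G=\mathbb Z_2^{2k+1}$ be the additive group of $\mathbb F_2^{2k+1}$, let $h(a)=\sum_{i=1}^k a_{2i-1}a_{2i}+a_{2k+1}^2$, and let $\beta(a,b)=(-1)^{h(a+b)-h(a)-h(b)}$. Put $$R^-=\{a\in G\setminus\mathrm{Rad}(\beta): h(a)=1\}.$$ Then: 1. $R^-$ is a skew root system of Lie type in $(G,\beta)$. 2. The corresponding reduced system $(\overline G,\overline\beta,\overline{R^-})$ is a reduced skew root system of Lie type. Moreover $\mathbb Z_2^{2k}\setminus\{0\}$ is a reduced skew root system of Lie type in $\mathbb Z_2^{2k}$ equipped with the nonsingular bicharacter $\beta_0(a,b)=(-1)^{\sum_{i=1}^k(a_{2i-1}b_{2i}-a_{2i}b_{2i-1})}$, and the projection $(a_1,\dots,a_{2k+1})\mapsto(a_1,\dots,a_{2k})$ induces a group isomorphism $\overline G\cong\mathbb Z_2^{2k}$ carrying $\overline\beta$ to $\beta_0$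 and $\overline{R^-}$ onto $\mathbb Z_2^{2k}\setminus\{0\}$. 3. $R^-$ is nonreduced and indecomposable, and $|R^-|=2^{2k}-1$. 4. There are 2-cocycles $\xi$ on $G$ with $\beta(a,b)=\xi(a,b)\xi(b,a)^{-1}$, and for every such $\xi$ one has $L(R^-)\cong\mathfrak{sl}(2^k,F)$ as Lie algebras over $F$. -/

import Mathlib

namespace SkewRoot

/-- An alternating bicharacter `β : G × G → Fˣ` of an additive abelian group `G`: it is biadditive
and `β(g, g) = 1` for all `g`.  A pair `(G, β)` is a symplectic abelian group. -/
@[ext]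
structure AltBichar (G F : Type*) [AddCommGroup G] [Field F] where
  toFun : G → G → Fˣ
  map_add_left : ∀ a b c, toFun (a + b) c = toFun a c * toFun b c
  map_add_right : ∀ a b c, toFun a (b + c) = toFun a b * toFun a c
  map_self : ∀ a, toFun a a = 1

namespace AltBichar

variable {G F : Type*} [AddCommGroup G] [Field F] (β : AltBichar G F)

theorem map_zero_left (b : G) : β.toFun 0 b = 1 := by
  simpa using β.map_add_left 0 0 b

theorem map_neg_left (a b : G) : β.toFun (-a) b = (β.toFun a b)⁻¹ := by
  have h := β.map_add_left (-a) a b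
  rw [neg_add_cancel, map_zero_left] at h
  exact eq_inv_of_mul_eq_one_left h.symm

theorem map_swap (a b : G) : β.toFun b a = (β.toFun a b)⁻¹ := by
  have h := β.map_self (a + b)
  rw [β.map_add_left, β.map_add_right, β.map_add_right, β.map_self, β.map_self, one_mul,
    mul_one] at h
  exact eq_inv_of_mul_eq_one_right h

/-- The radical `{g ∈ G | β(g, h) = 1 for all h ∈ G}`. -/
def radical : AddSubgroup G where
  carrier := {g | ∀ h, β.toFun g h = 1}
  zero_mem' := fun h => β.map_zero_left h
  add_mem' := fun {a b} ha hb h => by rw [β.map_add_left, ha h, hb h, one_mul]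
  neg_mem' := fun {a} ha h => by rw [β.map_neg_left, ha h, inv_one]

/-- `(G, β)` is nonsingular if the radical is zero. -/
def Nonsingular : Prop := β.radical = ⊥

/-- The restriction of `β` to a subgroup. -/
def restrict (H : AddSubgroup G) : AltBichar H F where
  toFun a b := β.toFun a b
  map_add_left a b c := β.map_add_left a b c
  map_add_right a b c := β.map_add_right a b c
  map_self a := β.map_self a

theorem toFun_congr {a a' b b' : G} (ha : -a + a' ∈ β.radical) (hb : -b + b' ∈ β.radical) :
    β.toFun a b = β.toFun a' b' := by
  have h1 : β.toFun a b = β.toFun a' b := by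
    have h := ha b
    rw [β.map_add_left, β.map_neg_left, inv_mul_eq_one] at h
    exact h
  have h2 : β.toFun b a' = β.toFun b' a' := by
    have h := hb a'
    rw [β.map_add_left, β.map_neg_left, inv_mul_eq_one] at h
    exact h
  rw [h1, β.map_swap b a', h2, ← β.map_swap]

/-- The alternating bicharacter induced by `β` on the quotient of `G` by the radical. -/
def quotient : AltBichar (G ⧸ β.radical) F where
  toFun := Quotient.lift₂ β.toFun (fun _ _ _ _ ha hb =>
    β.toFun_congr (QuotientAddGroup.leftRel_apply.mp ha) (QuotientAddGroup.leftRel_apply.mp hb))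
  map_add_left := by
    rintro ⟨a⟩ ⟨b⟩ ⟨c⟩
    exact β.map_add_left a b c
  map_add_right := by
    rintro ⟨a⟩ ⟨b⟩ ⟨c⟩
    exact β.map_add_right a b c
  map_self := by
    rintro ⟨a⟩
    exact β.map_self a

theorem quotient_mk (a b : G) :
    β.quotient.toFun (QuotientAddGroup.mk a) (QuotientAddGroup.mk b) = β.toFun a b := rfl

end AltBichar

section SkewRootSystem

variable {G F : Type*} [AddCommGroup G] [Field F]

/-- `R` is a skew root system of Lie type in the symplectic abelian group `(G, β)`. -/
structure IsLieType (β : AltBichar G F) (R : Set G) : Prop where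
  nontrivial : β.radical ≠ ⊤
  notMem_radical : ∀ a ∈ R, a ∉ β.radical
  closure_eq_top : AddSubgroup.closure R = ⊤
  neg_mem : ∀ a ∈ R, -a ∈ R
  add_mem : ∀ a ∈ R, ∀ b ∈ R, β.toFun a b ≠ 1 → a + b ∈ R

/-- `(G, β, R)` is decomposable: `G` is the orthogonal direct sum of two proper subgroups
`G₁`, `G₂`, and `R` is the union of two orthogonal subsets `R₁`, `R₂` such that `Rᵢ` is a skew root
system of Lie type in `Gᵢ`. -/
def IsDecomposable (β : AltBichar G F) (R : Set G) : Prop :=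
  ∃ (G₁ G₂ : AddSubgroup G) (R₁ R₂ : Set G),
    G₁ ≠ ⊤ ∧ G₂ ≠ ⊤ ∧ IsCompl G₁ G₂ ∧ (∀ a ∈ G₁, ∀ b ∈ G₂, β.toFun a b = 1) ∧
    R = R₁ ∪ R₂ ∧ (∀ a ∈ R₁, ∀ b ∈ R₂, β.toFun a b = 1) ∧
    R₁ ⊆ G₁ ∧ R₂ ⊆ G₂ ∧
    IsLieType (β.restrict G₁) {x : G₁ | (x : G) ∈ R₁} ∧
    IsLieType (β.restrict G₂) {x : G₂ | (x : G) ∈ R₂}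

/-- The group isomorphism `φ` is an isomorphism `(G₁, β₁, R₁) ≅ (G₂, β₂, R₂)`. -/
def IsSkewIso {G₁ G₂ : Type*} [AddCommGroup G₁] [AddCommGroup G₂]
    (β₁ : AltBichar G₁ F) (R₁ : Set G₁) (β₂ : AltBichar G₂ F) (R₂ : Set G₂)
    (φ : G₁ ≃+ G₂) : Prop :=
  (∀ a b, β₂.toFun (φ a) (φ b) = β₁.toFun a b) ∧ φ '' R₁ = R₂

/-- The image of `R` in the quotient of `G` by the radical of `β`. -/
def reducedSet (β : AltBichar G F) (R : Set G) : Set (G ⧸ β.radical) :=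
  (fun a : G => (QuotientAddGroup.mk a : G ⧸ β.radical)) '' R

end SkewRootSystem

/-- A 2-cocycle `ξ ∈ Z²(G, Fˣ)` for the trivial action (not necessarily normalized). -/
structure TwoCocycle (G F : Type*) [AddCommGroup G] [Field F] where
  toFun : G → G → Fˣ
  cocycle : ∀ a b c, toFun a b * toFun (a + b) c = toFun b c * toFun a (b + c)

/-- `ξ` corresponds to `β`, that is `β(a, b) = ξ(a, b) ξ(b, a)⁻¹`. -/
def TwoCocycle.Corresponds {G F : Type*} [AddCommGroup G] [Field F]
    (ξ : TwoCocycle G F) (β : AltBichar G F) : Prop :=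
  ∀ a b, β.toFun a b = ξ.toFun a b * (ξ.toFun b a)⁻¹

/-- The underlying space of the twisted group algebra `F^ξ G`: the vector space with basis
`u_g`, `g ∈ G`. -/
def TwistedGroupAlgebra {G F : Type*} [AddCommGroup G] [Field F] (_ξ : TwoCocycle G F) :=
  G →₀ F

namespace TwistedGroupAlgebra

variable {G F : Type*} [AddCommGroup G] [Field F] (ξ : TwoCocycle G F)

noncomputable instance : AddCommGroup (TwistedGroupAlgebra ξ) :=
  inferInstanceAs (AddCommGroup (G →₀ F))

noncomputable instance : Module F (TwistedGroupAlgebra ξ) :=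
  inferInstanceAs (Module F (G →₀ F))

/-- The basis vectors `u_g`. -/
noncomputable def basis : Module.Basis G F (TwistedGroupAlgebra ξ) :=
  Module.Basis.ofRepr (LinearEquiv.refl F (G →₀ F))

/-- The bilinear extension of `u_a u_b = ξ(a, b) u_{a+b}`. -/
noncomputable def mulLin :
    TwistedGroupAlgebra ξ →ₗ[F] TwistedGroupAlgebra ξ →ₗ[F] TwistedGroupAlgebra ξ :=
  (basis ξ).constr F fun a => (basis ξ).constr F fun b =>
    (ξ.toFun a b : F) • basis ξ (a + b)

noncomputable instance : Mul (TwistedGroupAlgebra ξ) := ⟨fun x y => mulLin ξ x y⟩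

noncomputable instance : One (TwistedGroupAlgebra ξ) :=
  ⟨((ξ.toFun 0 0)⁻¹ : Fˣ).val • basis ξ 0⟩

theorem mul_def (x y : TwistedGroupAlgebra ξ) : x * y = mulLin ξ x y := rfl

theorem one_def : (1 : TwistedGroupAlgebra ξ) = ((ξ.toFun 0 0)⁻¹ : Fˣ).val • basis ξ 0 := rfl

theorem mulLin_basis (a b : G) :
    mulLin ξ (basis ξ a) (basis ξ b) = (ξ.toFun a b : F) • basis ξ (a + b) := by
  simp [mulLin, Module.Basis.constr_basis]

theorem basis_mul_basis (a b : G) :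
    basis ξ a * basis ξ b = (ξ.toFun a b : F) • basis ξ (a + b) := mulLin_basis ξ a b

theorem cocycle_zero_left (a : G) : ξ.toFun 0 a = ξ.toFun 0 0 := by
  have h := ξ.cocycle 0 0 a
  simp only [zero_add] at h
  exact (mul_right_cancel h).symm

theorem cocycle_zero_right (a : G) : ξ.toFun a 0 = ξ.toFun 0 0 := by
  have h := ξ.cocycle a 0 0
  simp only [add_zero] at h
  exact mul_right_cancel h

theorem mul_assoc_aux (x y z : TwistedGroupAlgebra ξ) : x * y * z = x * (y * z) := by
  have h : (LinearMap.llcomp F _ _ _ (mulLin ξ)).flip.flip ∘ₗ mulLin ξ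
      = ((LinearMap.llcomp F _ _ _).flip (mulLin ξ)) ∘ₗ
        (LinearMap.llcomp F (TwistedGroupAlgebra ξ) (TwistedGroupAlgebra ξ)
          (TwistedGroupAlgebra ξ)) ∘ₗ mulLin ξ := by
    refine (basis ξ).ext fun a => (basis ξ).ext fun b => (basis ξ).ext fun c => ?_
    have hc := congrArg Units.val (ξ.cocycle a b c)
    push_cast at hc
    simp [mulLin_basis, smul_smul, add_assoc, hc]
  have := congrArg (fun f => f x y z) h
  simpa [mul_def] using this

noncomputable instance : Ring (TwistedGroupAlgebra ξ) where
  __ := (inferInstance : AddCommGroup (TwistedGroupAlgebra ξ))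
  left_distrib x y z := by simp [mul_def]
  right_distrib x y z := by simp [mul_def]
  zero_mul x := by simp [mul_def]
  mul_zero x := by simp [mul_def]
  mul_assoc := mul_assoc_aux ξ
  one_mul x := by
    have h : mulLin ξ 1 = LinearMap.id := (basis ξ).ext fun a => by
      simp [one_def, mulLin_basis, cocycle_zero_left ξ a, smul_smul]
    rw [mul_def, h, LinearMap.id_apply]
  mul_one x := by
    have h : (mulLin ξ).flip 1 = LinearMap.id := (basis ξ).ext fun a => by
      simp [one_def, mulLin_basis, cocycle_zero_right ξ a, smul_smul]
    rw [mul_def, ← LinearMap.flip_apply, h, LinearMap.id_apply]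

noncomputable instance : Algebra F (TwistedGroupAlgebra ξ) :=
  Algebra.ofModule (fun r x y => by simp [mul_def]) (fun r x y => by simp [mul_def])

/-- The commutator bracket `[x, y] = xy - yx`. -/
noncomputable instance : LieRing (TwistedGroupAlgebra ξ) := LieRing.ofAssociativeRing

theorem lie_def (x y : TwistedGroupAlgebra ξ) : ⁅x, y⁆ = x * y - y * x := rfl

noncomputable instance : LieAlgebra F (TwistedGroupAlgebra ξ) := LieAlgebra.ofAssociativeAlgebra

end TwistedGroupAlgebra

/-- The Lie algebra `L(R) = ⊕_{a ∈ R} F u_a`, a Lie subalgebra of `F^ξ G` with the commutator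
bracket, attached to a skew root system `R` of Lie type in `(G, β)` and a 2-cocycle `ξ`
corresponding to `β`. -/
noncomputable def lieAlgebraOf {G F : Type*} [AddCommGroup G] [Field F] {β : AltBichar G F}
    {R : Set G} (hR : IsLieType β R) (ξ : TwoCocycle G F) (hξ : ξ.Corresponds β) :
    LieSubalgebra F (TwistedGroupAlgebra ξ) where
  toSubmodule := Submodule.span F (TwistedGroupAlgebra.basis ξ '' R)
  lie_mem' := by
    intro x y hx hy
    change x ∈ Submodule.span F (TwistedGroupAlgebra.basis ξ '' R) at hx
    change y ∈ Submodule.span F (TwistedGroupAlgebra.basis ξ '' R) at hy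
    change ⁅x, y⁆ ∈ Submodule.span F (TwistedGroupAlgebra.basis ξ '' R)
    induction hx, hy using Submodule.span_induction₂ with
    | mem_mem x y hx hy =>
      obtain ⟨a, ha, rfl⟩ := hx
      obtain ⟨b, hb, rfl⟩ := hy
      rw [TwistedGroupAlgebra.lie_def, TwistedGroupAlgebra.basis_mul_basis,
        TwistedGroupAlgebra.basis_mul_basis, add_comm b a, ← sub_smul]
      by_cases h : β.toFun a b = 1
      · rw [hξ a b, mul_inv_eq_one] at h
        simp [h]
      · exact Submodule.smul_mem _ _
          (Submodule.subset_span ⟨_, hR.add_mem a ha b hb h, rfl⟩)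
    | zero_left y hy => simp
    | zero_right x hx => simp
    | add_left x y z hx hy hz h1 h2 => rw [add_lie]; exact add_mem h1 h2
    | add_right x y z hx hy hz h1 h2 => rw [lie_add]; exact add_mem h1 h2
    | smul_left r x y hx hy h => rw [smul_lie]; exact Submodule.smul_mem _ _ h
    | smul_right r x y hx hy h => rw [lie_smul]; exact Submodule.smul_mem _ _ h

/-- `(-1)^x ∈ Fˣ` for `x ∈ 𝔽₂`. -/
def signPow (F : Type*) [Field F] (x : ZMod 2) : Fˣ := (-1) ^ x.val

theorem signPow_add (F : Type*) [Field F] (x y : ZMod 2) :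
    signPow F (x + y) = signPow F x * signPow F y := by
  have h : (x + y).val = (x.val + y.val) % 2 := ZMod.val_add x y
  rw [signPow, signPow, signPow, h, ← pow_add]
  exact Units.ext (by simpa using (neg_one_pow_eq_pow_mod_two (R := F) (x.val + y.val)).symm)

/-- The alternating bicharacter `β(a, b) = (-1)^{q(a+b) - q(a) - q(b)}` defined by the polarization
of a quadratic form `q` over `𝔽₂`. -/
def quadBichar (F : Type*) [Field F] {V : Type*} [AddCommGroup V] [Module (ZMod 2) V]
    (q : QuadraticForm (ZMod 2) V) : AltBichar V F where
  toFun a b := signPow F (QuadraticMap.polar q a b)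
  map_add_left a b c := by rw [QuadraticMap.polar_add_left, signPow_add]
  map_add_right a b c := by rw [QuadraticMap.polar_add_right, signPow_add]
  map_self a := by
    have h : (2 : ZMod 2) = 0 := rfl
    rw [QuadraticMap.polar_self, two_smul, CharTwo.add_self_eq_zero]
    simp [signPow]

/-- The quadratic form `h(a) = ∑_{i=1}^k a_{2i-1} a_{2i} + a_{2k+1}²` on `𝔽₂^{2k+1}`; the
coordinates are numbered from `0` to `2k` here. -/
def hForm (k : ℕ) : QuadraticForm (ZMod 2) (Fin (2 * k + 1) → ZMod 2) :=
  (∑ i : Fin k, QuadraticMap.linMulLin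
      (LinearMap.proj (⟨2 * i.val, by omega⟩ : Fin (2 * k + 1)))
      (LinearMap.proj (⟨2 * i.val + 1, by omega⟩ : Fin (2 * k + 1)))) +
    QuadraticMap.linMulLin (LinearMap.proj (Fin.last (2 * k))) (LinearMap.proj (Fin.last (2 * k)))

theorem hForm_apply (k : ℕ) (a : Fin (2 * k + 1) → ZMod 2) :
    hForm k a = ∑ i : Fin k, a ⟨2 * i.val, by omega⟩ * a ⟨2 * i.val + 1, by omega⟩ +
      a (Fin.last (2 * k)) ^ 2 := by
  simp [hForm, sq]

/-- The alternating bicharacter on `ℤ₂^{2k+1}` defined by the polarization of `h`. -/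
def hBichar (F : Type*) [Field F] (k : ℕ) : AltBichar (Fin (2 * k + 1) → ZMod 2) F :=
  quadBichar F (hForm k)

/-- The set `R⁻ = {a ∈ G ∖ Rad β | h(a) = 1}`. -/
def RMinus (F : Type*) [Field F] (k : ℕ) : Set (Fin (2 * k + 1) → ZMod 2) :=
  {a | a ∉ (hBichar F k).radical ∧ hForm k a = 1}

/-- The symplectic abelian group `ℤ₂^{2k}`, the orthogonal direct sum of `k` copies of `ℤ₂ × ℤ₂`
with `((i, j), (s, t)) ↦ (-1)^{it - js}`; the `i`-th copy has the coordinates `2i, 2i+1`. -/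
def stdBichar (F : Type*) [Field F] (k : ℕ) : AltBichar (Fin (2 * k) → ZMod 2) F where
  toFun a b := signPow F (∑ i : Fin k,
    (a ⟨2 * i.val, by omega⟩ * b ⟨2 * i.val + 1, by omega⟩ -
      a ⟨2 * i.val + 1, by omega⟩ * b ⟨2 * i.val, by omega⟩))
  map_add_left a b c := by
    rw [← signPow_add, ← Finset.sum_add_distrib]
    congr 1
    refine Finset.sum_congr rfl fun i _ => ?_
    simp only [Pi.add_apply]
    ring
  map_add_right a b c := by
    rw [← signPow_add, ← Finset.sum_add_distrib]
    congr 1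
    refine Finset.sum_congr rfl fun i _ => ?_
    simp only [Pi.add_apply]
    ring
  map_self a := by
    have h : ∀ i : Fin k, a ⟨2 * i.val, by omega⟩ * a ⟨2 * i.val + 1, by omega⟩ -
        a ⟨2 * i.val + 1, by omega⟩ * a ⟨2 * i.val, by omega⟩ = 0 := fun i => by ring
    simp [h, signPow]

end SkewRoot

namespace SkewRoot

/-! Write `a = (x, t)` with `x ∈ 𝔽₂^{2k}` and `t` the last coordinate. As `t² = t`, `h(a) = q(x) +
t` with `q` hyperbolic, so polarizing `h` gives the symplectic form of the `x`-parts. Hence the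
radical is the line `x = 0`, and above each `x ≠ 0` lies exactly one root, the one with `t = q(x) +
1`. This bijection gives the reduced system and the cardinality (`initHom_image_RMinus`,
`initHom_injOn_RMinus`). Indecomposability holds because two nonzero vectors always have a common
non-orthogonal partner (`exists_sympForm_eq_one_and`).

For the Lie algebra, two cocycles with the same `β` have a symmetric quotient, which is a coboundary
over an algebraically closed field. So, after rescaling, the Heisenberg matrices of size `2^k`
represent `F^ξ G` for every `ξ`. A matrix with `x ≠ 0` is traceless, since it anticommutes with an
invertible one. Therefore the matrices of the roots are orthogonal and non-isotropic for the trace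
form, hence independent, and their number `2^{2k} - 1` is the dimension of `sl(2^k)`. -/

theorem zmod_two_eq_zero_or_one (x : ZMod 2) : x = 0 ∨ x = 1 := by
  revert x; decide

theorem signPow_zero (F : Type*) [Field F] : signPow F 0 = 1 := by simp [signPow]

theorem signPow_one (F : Type*) [Field F] : signPow F 1 = -1 := by
  have : (1 : ZMod 2).val = 1 := rfl
  simp [signPow, this]

theorem signPow_eq_one_iff {F : Type*} [Field F] [CharZero F] (x : ZMod 2) :
    signPow F x = 1 ↔ x = 0 := by
  rcases zmod_two_eq_zero_or_one x with rfl | rfl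
  · simp [signPow_zero]
  · have h : (-1 : Fˣ) ≠ 1 := fun h => by
      have h' : (-1 : F) = 1 := by simpa using congrArg Units.val h
      have : (1 : F) + 1 = 0 := by linear_combination -h'
      norm_num at this
    simp [signPow_one, h]

theorem signPow_inv (F : Type*) [Field F] (x : ZMod 2) : (signPow F x)⁻¹ = signPow F x := by
  rw [inv_eq_iff_mul_eq_one, ← signPow_add, CharTwo.add_self_eq_zero, signPow_zero]

/-! ### The symplectic form on `𝔽₂^{2k}`. -/

/-- The index `2i` of the first coordinate of the `i`-th hyperbolic plane. -/
abbrev evenIdx {k : ℕ} (i : Fin k) : Fin (2 * k) := ⟨2 * i.val, by omega⟩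

/-- The index `2i+1` of the second coordinate of the `i`-th hyperbolic plane. -/
abbrev oddIdx {k : ℕ} (i : Fin k) : Fin (2 * k) := ⟨2 * i.val + 1, by omega⟩

theorem eq_evenIdx_or_oddIdx {k : ℕ} (j : Fin (2 * k)) :
    ∃ i : Fin k, j = evenIdx i ∨ j = oddIdx i := by
  refine ⟨⟨j.val / 2, by omega⟩, ?_⟩
  rcases Nat.mod_two_eq_zero_or_one j.val with h | h
  · left; ext; simp; omega
  · right; ext; simp; omega

theorem eq_zero_of_evenIdx_oddIdx {k : ℕ} {x : Fin (2 * k) → ZMod 2}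
    (h0 : ∀ i : Fin k, x (evenIdx i) = 0) (h1 : ∀ i : Fin k, x (oddIdx i) = 0) : x = 0 := by
  ext j
  obtain ⟨i, rfl | rfl⟩ := eq_evenIdx_or_oddIdx j
  · exact h0 i
  · exact h1 i

/-- The hyperbolic quadratic function `∑ x_{2i} x_{2i+1}`. -/
def hypForm {k : ℕ} (x : Fin (2 * k) → ZMod 2) : ZMod 2 :=
  ∑ i : Fin k, x (evenIdx i) * x (oddIdx i)

/-- The alternating form `∑ (x_{2i} y_{2i+1} - x_{2i+1} y_{2i})`. -/
def sympForm {k : ℕ} (x y : Fin (2 * k) → ZMod 2) : ZMod 2 :=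
  ∑ i : Fin k, (x (evenIdx i) * y (oddIdx i) - x (oddIdx i) * y (evenIdx i))

theorem stdBichar_apply (F : Type*) [Field F] {k : ℕ} (x y : Fin (2 * k) → ZMod 2) :
    (stdBichar F k).toFun x y = signPow F (sympForm x y) := rfl

theorem stdBichar_eq_one_iff {F : Type*} [Field F] [CharZero F] {k : ℕ}
    (x y : Fin (2 * k) → ZMod 2) : (stdBichar F k).toFun x y = 1 ↔ sympForm x y = 0 := by
  rw [stdBichar_apply, signPow_eq_one_iff]

theorem sympForm_add_right {k : ℕ} (x y z : Fin (2 * k) → ZMod 2) :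
    sympForm x (y + z) = sympForm x y + sympForm x z := by
  simp only [sympForm, ← Finset.sum_add_distrib, Pi.add_apply]
  exact Finset.sum_congr rfl fun i _ => by ring

theorem sympForm_single_evenIdx {k : ℕ} (x : Fin (2 * k) → ZMod 2) (i : Fin k) :
    sympForm x (Pi.single (evenIdx i) 1) = - x (oddIdx i) := by
  have h1 (j : Fin k) : (Pi.single (evenIdx i) 1 : Fin (2 * k) → ZMod 2) (oddIdx j) = 0 :=
    Pi.single_eq_of_ne (by simp [Fin.ext_iff]; omega) _
  have h2 (j : Fin k) : (Pi.single (evenIdx i) 1 : Fin (2 * k) → ZMod 2) (evenIdx j)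
      = if j = i then 1 else 0 := by
    simp only [Pi.single_apply, Fin.ext_iff]
    congr 1; simp
  simp [sympForm, h1, h2]

theorem sympForm_single_oddIdx {k : ℕ} (x : Fin (2 * k) → ZMod 2) (i : Fin k) :
    sympForm x (Pi.single (oddIdx i) 1) = x (evenIdx i) := by
  have h1 (j : Fin k) : (Pi.single (oddIdx i) 1 : Fin (2 * k) → ZMod 2) (evenIdx j) = 0 :=
    Pi.single_eq_of_ne (by simp [Fin.ext_iff]; omega) _
  have h2 (j : Fin k) : (Pi.single (oddIdx i) 1 : Fin (2 * k) → ZMod 2) (oddIdx j)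
      = if j = i then 1 else 0 := by
    simp only [Pi.single_apply, Fin.ext_iff]
    congr 1; simp
  simp [sympForm, h1, h2]

theorem exists_sympForm_eq_one {k : ℕ} {x : Fin (2 * k) → ZMod 2} (hx : x ≠ 0) :
    ∃ y, sympForm x y = 1 := by
  by_contra! h
  have h' (y) : sympForm x y = 0 := (zmod_two_eq_zero_or_one _).resolve_right (h y)
  refine hx (eq_zero_of_evenIdx_oddIdx (fun i => ?_) fun i => ?_)
  · rw [← sympForm_single_oddIdx x, h']
  · rw [← neg_eq_zero, ← sympForm_single_evenIdx x, h']

theorem exists_sympForm_eq_one_and {k : ℕ} {x y : Fin (2 * k) → ZMod 2} (hx : x ≠ 0)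
    (hy : y ≠ 0) : ∃ z, sympForm x z = 1 ∧ sympForm y z = 1 := by
  obtain ⟨c, hc⟩ := exists_sympForm_eq_one hx
  obtain ⟨d, hd⟩ := exists_sympForm_eq_one hy
  rcases zmod_two_eq_zero_or_one (sympForm y c) with h1 | h1
  · rcases zmod_two_eq_zero_or_one (sympForm x d) with h2 | h2
    -- Here `c` pairs nontrivially only with `x`, and `d` only with `y`, so the sum serves both.
    · exact ⟨c + d, by simp [sympForm_add_right, *], by simp [sympForm_add_right, *]⟩
    · exact ⟨d, h2, hd⟩
  · exact ⟨c, hc, h1⟩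

theorem stdBichar_nonsingular (F : Type*) [Field F] [CharZero F] (k : ℕ) :
    (stdBichar F k).Nonsingular := by
  rw [AltBichar.Nonsingular, eq_bot_iff]
  intro x hx
  by_contra h
  obtain ⟨y, hy⟩ := exists_sympForm_eq_one h
  have := (stdBichar_eq_one_iff x y).1 (hx y)
  simp [hy] at this

theorem stdBichar_isLieType (F : Type*) [Field F] [CharZero F] {k : ℕ} (hk : 0 < k) :
    IsLieType (stdBichar F k) {a | a ≠ 0} where
  nontrivial := by
    rw [stdBichar_nonsingular F k]
    have : Nonempty (Fin (2 * k)) := ⟨⟨0, by omega⟩⟩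
    exact bot_ne_top
  notMem_radical a ha h := by
    rw [stdBichar_nonsingular F k] at h
    exact ha h
  closure_eq_top := by
    rw [eq_top_iff]
    rintro a -
    by_cases ha : a = 0
    · rw [ha]; exact zero_mem _
    · exact AddSubgroup.subset_closure ha
  neg_mem a ha := neg_ne_zero.2 ha
  add_mem a _ b _ hab h := by
    -- If `a + b = 0`, then `β(a, b) = β(b, b)⁻¹ = 1`.
    rw [eq_neg_of_add_eq_zero_left h, AltBichar.map_neg_left, AltBichar.map_self, inv_one] at hab
    exact hab rfl

/-! ### The form `h`, its radical, and the roots above nonzero vectors. -/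

/-- The projection of `ℤ₂^{2k+1}` onto the first `2k` coordinates. -/
def initHom (k : ℕ) : (Fin (2 * k + 1) → ZMod 2) →+ (Fin (2 * k) → ZMod 2) where
  toFun a i := a i.castSucc
  map_zero' := rfl
  map_add' _ _ := rfl

theorem initHom_snoc {k : ℕ} (x : Fin (2 * k) → ZMod 2) (t : ZMod 2) :
    initHom k (Fin.snoc x t : Fin (2 * k + 1) → ZMod 2) = x := by
  ext i; simp [initHom]

theorem initHom_surjective (k : ℕ) : Function.Surjective (initHom k) :=
  fun x => ⟨_, initHom_snoc x 0⟩

theorem hForm_eq {k : ℕ} (a : Fin (2 * k + 1) → ZMod 2) :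
    hForm k a = hypForm (initHom k a) + a (Fin.last _) := by
  have h : a (Fin.last (2 * k)) ^ 2 = a (Fin.last (2 * k)) := by
    rcases zmod_two_eq_zero_or_one (a (Fin.last (2 * k))) with h | h <;> simp [h]
  rw [hForm_apply, h]
  rfl

theorem hypForm_add {k : ℕ} (x y : Fin (2 * k) → ZMod 2) :
    hypForm (x + y) = hypForm x + hypForm y + sympForm x y := by
  simp only [hypForm, sympForm, ← Finset.sum_add_distrib, Pi.add_apply]
  refine Finset.sum_congr rfl fun i _ => ?_
  rw [CharTwo.sub_eq_add]
  ring

/-- The last coordinate enters `h` additively, so it cancels in the polarization. -/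
theorem polar_hForm {k : ℕ} (a b : Fin (2 * k + 1) → ZMod 2) :
    QuadraticMap.polar (hForm k) a b = sympForm (initHom k a) (initHom k b) := by
  rw [QuadraticMap.polar, hForm_eq, hForm_eq, hForm_eq, map_add, hypForm_add, Pi.add_apply]
  ring

theorem hBichar_apply (F : Type*) [Field F] {k : ℕ} (a b : Fin (2 * k + 1) → ZMod 2) :
    (hBichar F k).toFun a b = (stdBichar F k).toFun (initHom k a) (initHom k b) := by
  rw [stdBichar_apply, ← polar_hForm]
  rfl

theorem hForm_add {k : ℕ} (a b : Fin (2 * k + 1) → ZMod 2) :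
    hForm k (a + b) = hForm k a + hForm k b + sympForm (initHom k a) (initHom k b) := by
  rw [← polar_hForm, QuadraticMap.polar]
  ring

theorem mem_radical_hBichar_iff {F : Type*} [Field F] [CharZero F] {k : ℕ}
    (a : Fin (2 * k + 1) → ZMod 2) : a ∈ (hBichar F k).radical ↔ initHom k a = 0 := by
  have h : a ∈ (hBichar F k).radical ↔ initHom k a ∈ (stdBichar F k).radical := by
    refine ⟨fun h y => ?_, fun h b => ?_⟩
    · obtain ⟨b, rfl⟩ := initHom_surjective k y
      rw [← hBichar_apply]
      exact h b
    · rw [hBichar_apply]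
      exact h _
  rw [h, stdBichar_nonsingular F k, AddSubgroup.mem_bot]

theorem radical_hBichar (F : Type*) [Field F] [CharZero F] (k : ℕ) :
    (hBichar F k).radical = (initHom k).ker := by
  ext a
  rw [mem_radical_hBichar_iff, AddMonoidHom.mem_ker]

theorem mem_RMinus_iff {F : Type*} [Field F] [CharZero F] {k : ℕ}
    (a : Fin (2 * k + 1) → ZMod 2) : a ∈ RMinus F k ↔ initHom k a ≠ 0 ∧ hForm k a = 1 := by
  rw [ne_eq, ← mem_radical_hBichar_iff (F := F) a]
  rfl

/-- The element of `ℤ₂^{2k+1}` above `x` on which `h` takes the value `1`. -/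
def liftOne {k : ℕ} (x : Fin (2 * k) → ZMod 2) : Fin (2 * k + 1) → ZMod 2 :=
  Fin.snoc x (hypForm x + 1)

theorem initHom_liftOne {k : ℕ} (x : Fin (2 * k) → ZMod 2) : initHom k (liftOne x) = x :=
  initHom_snoc _ _

theorem liftOne_mem {F : Type*} [Field F] [CharZero F] {k : ℕ} {x : Fin (2 * k) → ZMod 2}
    (hx : x ≠ 0) : liftOne x ∈ RMinus F k := by
  rw [mem_RMinus_iff, hForm_eq, initHom_liftOne]
  refine ⟨hx, ?_⟩
  rw [liftOne, Fin.snoc_last, ← add_assoc, CharTwo.add_self_eq_zero, zero_add]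

/-- The equation `h(a) = 1` determines the last coordinate from the others. -/
theorem initHom_injOn_RMinus (F : Type*) [Field F] [CharZero F] (k : ℕ) :
    Set.InjOn (initHom k) (RMinus F k) := by
  intro a ha b hb h
  rw [mem_RMinus_iff, hForm_eq] at ha hb
  have hl : a (Fin.last _) = b (Fin.last _) := by
    have := ha.2.trans hb.2.symm
    rw [h] at this
    exact add_left_cancel this
  ext j
  refine Fin.lastCases hl (fun i => congrFun h i) j

theorem initHom_image_RMinus (F : Type*) [Field F] [CharZero F] (k : ℕ) :
    initHom k '' RMinus F k = {a | a ≠ 0} := by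
  ext x
  constructor
  · rintro ⟨a, ha, rfl⟩
    exact ((mem_RMinus_iff a).1 ha).1
  · exact fun hx => ⟨_, liftOne_mem hx, initHom_liftOne x⟩

theorem ncard_RMinus (F : Type*) [Field F] [CharZero F] (k : ℕ) :
    (RMinus F k).ncard = 2 ^ (2 * k) - 1 := by
  rw [← (initHom_injOn_RMinus F k).ncard_image, initHom_image_RMinus]
  have : {a : Fin (2 * k) → ZMod 2 | a ≠ 0} = {0}ᶜ := rfl
  rw [this, Set.ncard_compl, Set.ncard_singleton]
  simp

/-! ### `R⁻` is a skew root system of Lie type. -/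

/-- This is where `k ≥ 2` matters: for `k = 1` the three roots sum to zero and span only a plane.
With two hyperbolic planes, choose one isotropic vector in each. Then `q` vanishes at both and at
their sum, so all three lifts have last coordinate `1`, and adding them leaves `(0, 1)`. -/
theorem snoc_zero_one_mem_closure (F : Type*) [Field F] [CharZero F] {k : ℕ} (hk : 2 ≤ k) :
    (Fin.snoc 0 1 : Fin (2 * k + 1) → ZMod 2) ∈ AddSubgroup.closure (RMinus F k) := by
  have hQ (x : Fin (2 * k) → ZMod 2) (h : ∀ i : Fin k, x (oddIdx i) = 0) : hypForm x = 0 := by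
    simp [hypForm, h]
  let x : Fin (2 * k) → ZMod 2 := Pi.single (evenIdx ⟨0, by omega⟩) 1
  let y : Fin (2 * k) → ZMod 2 := Pi.single (evenIdx ⟨1, by omega⟩) 1
  have hx (i : Fin k) : x (oddIdx i) = 0 := Pi.single_eq_of_ne (by simp [Fin.ext_iff]) _
  have hy (i : Fin k) : y (oddIdx i) = 0 :=
    Pi.single_eq_of_ne (by simp [Fin.ext_iff]) _
  have hx0 : x ≠ 0 := by simp [x]
  have hy0 : y ≠ 0 := by simp [y]
  have hxy : x + y ≠ 0 := by
    intro h
    have := congrFun h (evenIdx ⟨0, by omega⟩)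
    simp [x, y] at this
  have key : (Fin.snoc 0 1 : Fin (2 * k + 1) → ZMod 2)
      = liftOne x + liftOne y + liftOne (x + y) := by
    ext j
    refine Fin.lastCases ?_ (fun i => ?_) j
    · simp only [liftOne, Pi.add_apply, Fin.snoc_last, hQ x hx, hQ y hy,
        hQ (x + y) fun i => by simp [hx, hy]]
      decide
    · simp only [liftOne, Pi.add_apply, Fin.snoc_castSucc, CharTwo.add_self_eq_zero,
        Pi.zero_apply]
  rw [key]
  exact add_mem (add_mem (AddSubgroup.subset_closure (liftOne_mem hx0))
    (AddSubgroup.subset_closure (liftOne_mem hy0))) (AddSubgroup.subset_closure (liftOne_mem hxy))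

theorem RMinus_isLieType (F : Type*) [Field F] [CharZero F] {k : ℕ} (hk : 2 ≤ k) :
    IsLieType (hBichar F k) (RMinus F k) where
  nontrivial h := by
    have := (mem_radical_hBichar_iff (F := F) (liftOne (Pi.single ⟨0, by omega⟩ 1 :
      Fin (2 * k) → ZMod 2))).1 (h ▸ AddSubgroup.mem_top _)
    simp [initHom_liftOne] at this
  notMem_radical a ha := ha.1
  closure_eq_top := by
    have hz := snoc_zero_one_mem_closure F hk
    -- The kernel of the projection is `{0, (0, 1)}`.
    have hfib (a : Fin (2 * k + 1) → ZMod 2) (ha : initHom k a = 0) :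
        a ∈ AddSubgroup.closure (RMinus F k) := by
      rcases zmod_two_eq_zero_or_one (a (Fin.last _)) with h | h
      · have : a = 0 := by
          ext j
          exact Fin.lastCases h (fun i => congrFun ha i) j
        rw [this]
        exact zero_mem _
      · have : a = Fin.snoc 0 1 := by
          ext j
          refine Fin.lastCases (by simpa using h) (fun i => ?_) j
          rw [Fin.snoc_castSucc]
          exact congrFun ha i
        rwa [this]
    rw [eq_top_iff]
    rintro a -
    by_cases ha : initHom k a = 0
    · exact hfib a ha
    · have := add_mem (hfib (a - liftOne (initHom k a)) (by simp [initHom_liftOne]))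
        (AddSubgroup.subset_closure (liftOne_mem (F := F) ha))
      simpa using this
  neg_mem a ha := by
    rwa [show -a = a from funext fun i => ZMod.neg_eq_self_mod_two _]
  add_mem a ha b hb hab := by
    rw [hBichar_apply, ne_eq, stdBichar_eq_one_iff] at hab
    have hab' := (zmod_two_eq_zero_or_one _).resolve_left hab
    refine (mem_RMinus_iff _).2 ⟨fun h => hab ?_, ?_⟩
    · rw [map_add] at h
      rw [← stdBichar_eq_one_iff (F := F), eq_neg_of_add_eq_zero_left h, AltBichar.map_neg_left,
        AltBichar.map_self, inv_one]
    -- `h(a + b) = 1 + 1 + 1 = 1` in `𝔽₂`.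
    · rw [hForm_add, hab', ((mem_RMinus_iff a).1 ha).2, ((mem_RMinus_iff b).1 hb).2]
      decide

/-! ### Transport along isomorphisms and the reduced system. -/

theorem IsSkewIso.isLieType {F G₁ G₂ : Type*} [Field F] [AddCommGroup G₁] [AddCommGroup G₂]
    {β₁ : AltBichar G₁ F} {R₁ : Set G₁} {β₂ : AltBichar G₂ F} {R₂ : Set G₂} {φ : G₁ ≃+ G₂}
    (h : IsSkewIso β₁ R₁ β₂ R₂ φ) (h₂ : IsLieType β₂ R₂) : IsLieType β₁ R₁ := by
  have hrad (a : G₁) : a ∈ β₁.radical ↔ φ a ∈ β₂.radical :=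
    ⟨fun ha y => by simpa [← h.1] using ha (φ.symm y), fun ha b => by rw [← h.1]; exact ha _⟩
  have hmem (a : G₁) : a ∈ R₁ ↔ φ a ∈ R₂ := by
    rw [← h.2]
    exact (φ.injective.mem_set_image).symm
  refine ⟨fun ht => h₂.nontrivial ?_, fun a ha => ?_, ?_, fun a ha => ?_, fun a ha b hb hab => ?_⟩
  · rw [eq_top_iff]
    rintro y -
    have := (hrad (φ.symm y)).1 (ht ▸ AddSubgroup.mem_top _)
    simpa using this
  · rw [hrad]
    exact h₂.notMem_radical _ ((hmem a).1 ha)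
  · have := AddMonoidHom.map_closure φ.toAddMonoidHom R₁
    apply AddSubgroup.map_injective (f := φ.toAddMonoidHom) φ.injective
    rw [this]
    change AddSubgroup.closure (φ '' R₁) = _
    rw [h.2, h₂.closure_eq_top]
    exact (AddSubgroup.map_top_of_surjective _ φ.surjective).symm
  · rw [hmem, map_neg]
    exact h₂.neg_mem _ ((hmem a).1 ha)
  · rw [hmem, map_add]
    exact h₂.add_mem _ ((hmem a).1 ha) _ ((hmem b).1 hb) (by rwa [h.1])

theorem IsSkewIso.nonsingular {F G₁ G₂ : Type*} [Field F] [AddCommGroup G₁] [AddCommGroup G₂]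
    {β₁ : AltBichar G₁ F} {R₁ : Set G₁} {β₂ : AltBichar G₂ F} {R₂ : Set G₂} {φ : G₁ ≃+ G₂}
    (h : IsSkewIso β₁ R₁ β₂ R₂ φ) (h₂ : β₂.Nonsingular) : β₁.Nonsingular := by
  rw [AltBichar.Nonsingular, eq_bot_iff]
  intro a ha
  have : φ a ∈ β₂.radical := fun y => by simpa [← h.1] using ha (φ.symm y)
  rw [h₂, AddSubgroup.mem_bot] at this
  simpa using this

/-- The isomorphism `ℤ₂^{2k+1} / Rad β ≅ ℤ₂^{2k}` induced by the projection. -/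
noncomputable def reducedEquiv (F : Type*) [Field F] [CharZero F] (k : ℕ) :
    ((Fin (2 * k + 1) → ZMod 2) ⧸ (hBichar F k).radical) ≃+ (Fin (2 * k) → ZMod 2) :=
  (QuotientAddGroup.quotientAddEquivOfEq (radical_hBichar F k)).trans
    (QuotientAddGroup.quotientKerEquivOfSurjective (initHom k) (initHom_surjective k))

theorem reducedEquiv_isSkewIso (F : Type*) [Field F] [CharZero F] (k : ℕ) :
    IsSkewIso (hBichar F k).quotient (reducedSet (hBichar F k) (RMinus F k)) (stdBichar F k)
      {a | a ≠ 0} (reducedEquiv F k) := by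
  refine ⟨?_, ?_⟩
  · rintro ⟨a⟩ ⟨b⟩
    exact (hBichar_apply F a b).symm
  · rw [reducedSet, Set.image_image, ← initHom_image_RMinus F k]
    rfl

theorem hBichar_not_nonsingular (F : Type*) [Field F] [CharZero F] (k : ℕ) :
    ¬ (hBichar F k).Nonsingular := by
  intro h
  have : (Fin.snoc 0 1 : Fin (2 * k + 1) → ZMod 2) ∈ (hBichar F k).radical := by
    rw [mem_radical_hBichar_iff, initHom_snoc]
  rw [h, AddSubgroup.mem_bot] at this
  simpa using congrFun this (Fin.last _)

/-! ### Indecomposability. -/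

/-- The empty set generates only `0`, which would make the whole group equal to its radical. -/
theorem IsLieType.nonempty {F G : Type*} [Field F] [AddCommGroup G] {β : AltBichar G F}
    {R : Set G} (h : IsLieType β R) : R.Nonempty := by
  rw [Set.nonempty_iff_ne_empty]
  rintro rfl
  have h1 := h.closure_eq_top
  rw [AddSubgroup.closure_empty] at h1
  exact h.nontrivial (top_le_iff.1 (h1 ▸ bot_le))

/-- Take `a ∈ R₁`, `b ∈ R₂` and a root above some `z` that is non-orthogonal to the projections of
both: it can belong to neither `R₁` nor `R₂`. -/
theorem RMinus_not_isDecomposable (F : Type*) [Field F] [CharZero F] (k : ℕ) :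
    ¬ IsDecomposable (hBichar F k) (RMinus F k) := by
  rintro ⟨G₁, G₂, R₁, R₂, -, -, -, -, hR, hperp, -, -, h₁, h₂⟩
  obtain ⟨⟨a, ha₁⟩, ha⟩ := h₁.nonempty
  obtain ⟨⟨b, hb₁⟩, hb⟩ := h₂.nonempty
  replace ha : a ∈ R₁ := ha
  replace hb : b ∈ R₂ := hb
  have ha' := ((mem_RMinus_iff (F := F) a).1 (hR ▸ Or.inl ha)).1
  have hb' := ((mem_RMinus_iff (F := F) b).1 (hR ▸ Or.inr hb)).1
  obtain ⟨z, hza, hzb⟩ := exists_sympForm_eq_one_and ha' hb'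
  have hz : z ≠ 0 := by
    rintro rfl
    simp [sympForm] at hza
  have hc : liftOne z ∈ R₁ ∪ R₂ := hR ▸ liftOne_mem (F := F) hz
  rcases hc with hc | hc
  · have := hperp _ hc _ hb
    rw [AltBichar.map_swap, inv_eq_one, hBichar_apply, stdBichar_eq_one_iff, initHom_liftOne,
      hzb] at this
    exact one_ne_zero this
  · have := hperp _ ha _ hc
    rw [hBichar_apply, stdBichar_eq_one_iff, initHom_liftOne, hza] at this
    exact one_ne_zero this

/-! ### Cocycles with the same `β` differ by a coboundary. -/

namespace TwistedGroupAlgebra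

variable {G F : Type*} [AddCommGroup G] [Field F]

theorem mul_comm_of_symm {ξ : TwoCocycle G F} (h : ∀ a b, ξ.toFun a b = ξ.toFun b a)
    (x y : TwistedGroupAlgebra ξ) : x * y = y * x := by
  have h' : mulLin ξ = (mulLin ξ).flip := by
    refine (basis ξ).ext fun a => (basis ξ).ext fun b => ?_
    rw [LinearMap.flip_apply, mulLin_basis, mulLin_basis, h, add_comm]
  rw [mul_def, mul_def, ← LinearMap.flip_apply (mulLin ξ) x y, ← h']

/-- A nonzero finite-dimensional commutative algebra over an algebraically closed field has a
character. -/
theorem _root_.IsAlgClosed.nonempty_algHom_of_finite (F A : Type*) [Field F] [IsAlgClosed F]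
    [CommRing A] [Nontrivial A] [Algebra F A] [Module.Finite F A] : Nonempty (A →ₐ[F] F) := by
  obtain ⟨M, hM⟩ := Ideal.exists_maximal A
  let := Ideal.Quotient.field M
  let e : F ≃ₐ[F] A ⧸ M := AlgEquiv.ofBijective (Algebra.ofId F (A ⧸ M))
    IsAlgClosed.algebraMap_bijective_of_isIntegral
  exact ⟨(e.symm : (A ⧸ M) →ₐ[F] F).comp (Ideal.Quotient.mkₐ F M)⟩

/-- Over an algebraically closed field, symmetric 2-cocycles on finite groups are coboundaries. -/
theorem exists_eq_coboundary [IsAlgClosed F] [Finite G] (ξ : TwoCocycle G F)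
    (h : ∀ a b, ξ.toFun a b = ξ.toFun b a) :
    ∃ f : G → Fˣ, ∀ a b, f a * f b = ξ.toFun a b * f (a + b) := by
  let : CommRing (TwistedGroupAlgebra ξ) :=
    { (inferInstance : Ring (TwistedGroupAlgebra ξ)) with mul_comm := mul_comm_of_symm h }
  have : Nontrivial (TwistedGroupAlgebra ξ) := ⟨⟨basis ξ 0, 0, (basis ξ).ne_zero 0⟩⟩
  have : Module.Finite F (TwistedGroupAlgebra ξ) := Module.Finite.of_basis (basis ξ)
  obtain ⟨χ⟩ := IsAlgClosed.nonempty_algHom_of_finite F (TwistedGroupAlgebra ξ)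
  -- The values of a character on the basis vectors provide the cochain.
  have hmul (a b : G) : χ (basis ξ a) * χ (basis ξ b) = ξ.toFun a b * χ (basis ξ (a + b)) := by
    rw [← map_mul, basis_mul_basis, map_smul, smul_eq_mul]
  have h0 : χ (basis ξ 0) ≠ 0 := by
    intro h0
    have := map_one χ
    rw [one_def, map_smul, h0, smul_zero] at this
    exact zero_ne_one this
  -- `u_a u_{-a}` is a nonzero multiple of `u_0`, on which the character does not vanish.
  have hne (a : G) : χ (basis ξ a) ≠ 0 := by
    intro ha
    have := hmul a (-a)
    rw [ha, zero_mul, add_neg_cancel] at this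
    exact mul_ne_zero (Units.ne_zero _) h0 this.symm
  exact ⟨fun a => Units.mk0 _ (hne a), fun a b => Units.ext (hmul a b)⟩

end TwistedGroupAlgebra

/-- The pointwise quotient of two 2-cocycles. -/
def TwoCocycle.div {G F : Type*} [AddCommGroup G] [Field F] (ξ η : TwoCocycle G F) :
    TwoCocycle G F where
  toFun a b := ξ.toFun a b / η.toFun a b
  cocycle a b c := by
    rw [div_mul_div_comm, div_mul_div_comm, ξ.cocycle, η.cocycle]

theorem TwoCocycle.Corresponds.exists_eq_coboundary_mul {G F : Type*} [AddCommGroup G] [Field F]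
    [IsAlgClosed F] [Finite G] {β : AltBichar G F} {ξ η : TwoCocycle G F} (hξ : ξ.Corresponds β)
    (hη : η.Corresponds β) :
    ∃ f : G → Fˣ, ∀ a b, f a * f b * η.toFun a b = ξ.toFun a b * f (a + b) := by
  -- Equality of the two commutator bicharacters says that `ξ/η` is symmetric.
  obtain ⟨f, hf⟩ := TwistedGroupAlgebra.exists_eq_coboundary (ξ.div η) fun a b => by
    have h := (hξ a b).symm.trans (hη a b)
    rw [← div_eq_mul_inv, ← div_eq_mul_inv] at h
    change ξ.toFun a b / η.toFun a b = ξ.toFun b a / η.toFun b a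
    rw [div_eq_div_iff_mul_eq_mul] at h ⊢
    rw [h, mul_comm]
  refine ⟨f, fun a b => ?_⟩
  rw [hf]
  change ξ.toFun a b / η.toFun a b * _ * _ = _
  rw [mul_right_comm, div_mul_cancel]

/-! ### Heisenberg matrices. -/

/-- The bilinear cocycle `(-1)^{∑ a_{2i+1} b_{2i}}`. -/
def heisenbergCocycle (F : Type*) [Field F] (k : ℕ) : TwoCocycle (Fin (2 * k + 1) → ZMod 2) F where
  toFun a b := signPow F (∑ i : Fin k, initHom k a (oddIdx i) * initHom k b (evenIdx i))
  cocycle a b c := by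
    rw [← signPow_add, ← signPow_add]
    congr 1
    simp only [← Finset.sum_add_distrib, map_add, Pi.add_apply]
    exact Finset.sum_congr rfl fun i _ => by ring

theorem heisenbergCocycle_corresponds (F : Type*) [Field F] (k : ℕ) :
    (heisenbergCocycle F k).Corresponds (hBichar F k) := by
  intro a b
  rw [hBichar_apply, stdBichar_apply, heisenbergCocycle]
  dsimp only
  rw [signPow_inv, ← signPow_add]
  congr 1
  simp only [sympForm, ← Finset.sum_add_distrib, CharTwo.sub_eq_add]
  exact Finset.sum_congr rfl fun i _ => by ring

/-- The matrix of the operator on functions on `ℤ₂^k` which multiplies by the character given by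
the odd coordinates of `a` and translates by the even coordinates of `a`. -/
def heisenbergMatrix (F : Type*) [Field F] {k : ℕ} (a : Fin (2 * k + 1) → ZMod 2) :
    Matrix (Fin k → ZMod 2) (Fin k → ZMod 2) F :=
  Matrix.of fun x y => if x = y + fun i => initHom k a (evenIdx i) then
    (signPow F (∑ i : Fin k, initHom k a (oddIdx i) * y i) : F) else 0

/-- Moving the character of `a` past the translation of `b` evaluates it at `y + b_even` instead of
`y`; the extra sign is the cocycle. -/
theorem heisenbergMatrix_mul (F : Type*) [Field F] {k : ℕ} (a b : Fin (2 * k + 1) → ZMod 2) :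
    heisenbergMatrix F a * heisenbergMatrix F b =
      ((heisenbergCocycle F k).toFun a b : F) • heisenbergMatrix F (a + b) := by
  ext x y
  rw [Matrix.mul_apply, Matrix.smul_apply]
  simp only [heisenbergMatrix, Matrix.of_apply, mul_ite, mul_zero, Finset.sum_ite_eq',
    Finset.mem_univ, if_true]
  have hiff : (x = (y + fun i => initHom k b (evenIdx i)) + fun i => initHom k a (evenIdx i)) ↔
      x = y + fun i => initHom k (a + b) (evenIdx i) := by
    rw [add_assoc, add_comm (fun i => initHom k b (evenIdx i))]
    exact Iff.rfl
  simp only [hiff]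
  split_ifs
  · rw [smul_eq_mul, heisenbergCocycle]
    dsimp only
    rw [← Units.val_mul, ← Units.val_mul, ← signPow_add, ← signPow_add]
    congr 2
    simp only [← Finset.sum_add_distrib, map_add, Pi.add_apply]
    exact Finset.sum_congr rfl fun i _ => by ring
  · simp

theorem heisenbergMatrix_zero (F : Type*) [Field F] (k : ℕ) :
    heisenbergMatrix F (0 : Fin (2 * k + 1) → ZMod 2) = 1 := by
  ext x y
  have : (y + fun _ : Fin k => 0) = y := add_zero y
  simp [heisenbergMatrix, this, Matrix.one_apply, signPow_zero]

/-- By nondegeneracy some `b` has `β(a, b) = -1`, so the two matrices anticommute. The square of the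
second is a nonzero scalar, and cyclicity of the trace gives `tr = -tr`. -/
theorem trace_heisenbergMatrix {F : Type*} [Field F] [CharZero F] {k : ℕ}
    {a : Fin (2 * k + 1) → ZMod 2} (ha : initHom k a ≠ 0) :
    (heisenbergMatrix F a).trace = 0 := by
  obtain ⟨y, hy⟩ := exists_sympForm_eq_one ha
  obtain ⟨b, rfl⟩ := initHom_surjective k y
  have hcorr := heisenbergCocycle_corresponds F k a b
  rw [hBichar_apply, stdBichar_apply, hy, signPow_one, eq_mul_inv_iff_mul_eq] at hcorr
  have hanti : heisenbergMatrix F a * heisenbergMatrix F b =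
      -(heisenbergMatrix F b * heisenbergMatrix F a) := by
    rw [heisenbergMatrix_mul, heisenbergMatrix_mul, ← hcorr, add_comm b a]
    simp
  have hsq : heisenbergMatrix F b * heisenbergMatrix F b =
      ((heisenbergCocycle F k).toFun b b : F) • 1 := by
    rw [heisenbergMatrix_mul, show b + b = 0 from funext fun i => CharTwo.add_self_eq_zero _,
      heisenbergMatrix_zero]
  have h1 : (heisenbergMatrix F a * heisenbergMatrix F b * heisenbergMatrix F b).trace =
      -(heisenbergMatrix F a * heisenbergMatrix F b * heisenbergMatrix F b).trace := by
    conv_lhs => rw [hanti, neg_mul, Matrix.trace_neg, Matrix.mul_assoc, Matrix.trace_mul_comm]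
  rw [self_eq_neg, Matrix.mul_assoc, hsq, Matrix.mul_smul, Matrix.mul_one, Matrix.trace_smul,
    smul_eq_zero] at h1
  exact h1.resolve_left (Units.ne_zero _)

/-- The Heisenberg matrices are rescaled by the cochain relating `ξ` to the Heisenberg cocycle. As
`ξ` need not be normalized, `ρ 0` is only a nonzero scalar matrix; its trace is nonzero in
characteristic `0`. -/
theorem exists_projective_representation {F : Type*} [Field F] [IsAlgClosed F] [CharZero F]
    {k : ℕ} {ξ : TwoCocycle (Fin (2 * k + 1) → ZMod 2) F} (hξ : ξ.Corresponds (hBichar F k)) :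
    ∃ ρ : (Fin (2 * k + 1) → ZMod 2) → Matrix (Fin (2 ^ k)) (Fin (2 ^ k)) F,
      (∀ a b, ρ a * ρ b = (ξ.toFun a b : F) • ρ (a + b)) ∧
      (∀ a, initHom k a ≠ 0 → (ρ a).trace = 0) ∧ (ρ 0).trace ≠ 0 := by
  obtain ⟨f, hf⟩ := hξ.exists_eq_coboundary_mul (heisenbergCocycle_corresponds F k)
  have e : (Fin k → ZMod 2) ≃ Fin (2 ^ k) := Fintype.equivFinOfCardEq (by simp)
  have htr (M : Matrix (Fin k → ZMod 2) (Fin k → ZMod 2) F) :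
      (Matrix.reindexAlgEquiv F F e M).trace = M.trace := by
    simp only [Matrix.trace, Matrix.diag_apply, Matrix.coe_reindexAlgEquiv,
      Matrix.reindex_apply, Matrix.submatrix_apply]
    exact e.symm.sum_comp fun i => M i i
  refine ⟨fun a => Matrix.reindexAlgEquiv F F e ((f a : F) • heisenbergMatrix F a),
    fun a b => ?_, fun a ha => ?_, ?_⟩
  · rw [← map_mul, ← map_smul, smul_mul_smul_comm, heisenbergMatrix_mul, smul_smul, smul_smul]
    congr 2
    exact congrArg Units.val (hf a b)
  · rw [htr, Matrix.trace_smul, trace_heisenbergMatrix ha, smul_zero]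
  · rw [htr, heisenbergMatrix_zero, Matrix.trace_smul, Matrix.trace_one]
    simp

/-! ### The isomorphism with `sl(2^k)`. -/

theorem finrank_sl (F : Type*) [Field F] (n : ℕ) [NeZero n] :
    Module.finrank F (LieAlgebra.SpecialLinear.sl (Fin n) F) = n ^ 2 - 1 := by
  have h0 : Matrix.traceLinearMap (Fin n) F F ≠ 0 := by
    intro h
    have := LinearMap.congr_fun h (Matrix.single 0 0 1)
    simp at this
  have h := Module.Dual.finrank_ker_add_one_of_ne_zero h0
  rw [Module.finrank_matrix, Fintype.card_fin, Module.finrank_self, mul_one] at h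
  change Module.finrank F (LinearMap.ker (Matrix.traceLinearMap (Fin n) F F)) = _
  rw [sq, ← h, Nat.add_sub_cancel]

namespace TwistedGroupAlgebra

variable {G F : Type*} [AddCommGroup G] [Field F]

theorem constr_mul {ξ : TwoCocycle G F} {A : Type*} [Ring A] [Algebra F A] {ρ : G → A}
    (hρ : ∀ a b, ρ a * ρ b = (ξ.toFun a b : F) • ρ (a + b)) (x y : TwistedGroupAlgebra ξ) :
    (basis ξ).constr F ρ (x * y) = (basis ξ).constr F ρ x * (basis ξ).constr F ρ y := by
  have h : (mulLin ξ).compr₂ ((basis ξ).constr F ρ) =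
      (LinearMap.mul F A).compl₁₂ ((basis ξ).constr F ρ) ((basis ξ).constr F ρ) := by
    refine (basis ξ).ext fun a => (basis ξ).ext fun b => ?_
    simp [mulLin_basis, hρ]
  exact LinearMap.congr_fun₂ h x y

end TwistedGroupAlgebra

theorem finrank_lieAlgebraOf {G F : Type*} [AddCommGroup G] [Field F] [Finite G]
    {β : AltBichar G F} {R : Set G} (hR : IsLieType β R) (ξ : TwoCocycle G F)
    (hξ : ξ.Corresponds β) : Module.finrank F (lieAlgebraOf hR ξ hξ) = R.ncard := by
  have := Fintype.ofFinite R
  have hli : LinearIndependent F fun a : R => TwistedGroupAlgebra.basis ξ a :=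
    (TwistedGroupAlgebra.basis ξ).linearIndependent.comp _ Subtype.val_injective
  have h := finrank_span_eq_card hli
  rw [← Nat.card_eq_fintype_card, Nat.card_coe_set_eq] at h
  rw [← h]
  change Module.finrank F (Submodule.span F (TwistedGroupAlgebra.basis ξ '' R)) = _
  rw [Set.image_eq_range]

theorem nonempty_lieAlgebraOf_equiv_sl {F : Type*} [Field F] [IsAlgClosed F] [CharZero F]
    {k : ℕ} (hR : IsLieType (hBichar F k) (RMinus F k))
    (ξ : TwoCocycle (Fin (2 * k + 1) → ZMod 2) F) (hξ : ξ.Corresponds (hBichar F k)) :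
    Nonempty (lieAlgebraOf hR ξ hξ ≃ₗ⁅F⁆ LieAlgebra.SpecialLinear.sl (Fin (2 ^ k)) F) := by
  obtain ⟨ρ, hρ, htr, htr0⟩ := exists_projective_representation hξ
  let Φ := (TwistedGroupAlgebra.basis ξ).constr F ρ
  have hΦ (a) : Φ (TwistedGroupAlgebra.basis ξ a) = ρ a :=
    (TwistedGroupAlgebra.basis ξ).constr_basis F ρ a
  have hmem (x : lieAlgebraOf hR ξ hξ) : Φ x ∈ LieAlgebra.SpecialLinear.sl (Fin (2 ^ k)) F := by
    obtain ⟨x, hx⟩ := x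
    change x ∈ Submodule.span F (TwistedGroupAlgebra.basis ξ '' RMinus F k) at hx
    have hle : Submodule.span F (TwistedGroupAlgebra.basis ξ '' RMinus F k) ≤
        (LinearMap.ker (Matrix.traceLinearMap (Fin (2 ^ k)) F F)).comap Φ := by
      rw [Submodule.span_le]
      rintro _ ⟨a, ha, rfl⟩
      change Matrix.trace (Φ _) = 0
      rw [hΦ]
      exact htr a ((mem_RMinus_iff a).1 ha).1
    exact hle hx
  let ψ : lieAlgebraOf hR ξ hξ →ₗ⁅F⁆ LieAlgebra.SpecialLinear.sl (Fin (2 ^ k)) F :=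
    { toFun := fun x => ⟨Φ x, hmem x⟩
      map_add' := fun x y => Subtype.ext (map_add Φ _ _)
      map_smul' := fun c x => Subtype.ext (map_smul Φ _ _)
      map_lie' := fun {x y} => Subtype.ext <| by
        change Φ ((x : TwistedGroupAlgebra ξ) * y - y * x) = Φ x * Φ y - Φ y * Φ x
        rw [map_sub, TwistedGroupAlgebra.constr_mul hρ, TwistedGroupAlgebra.constr_mul hρ] }
  have hdim : Module.finrank F (lieAlgebraOf hR ξ hξ) =
      Module.finrank F (LieAlgebra.SpecialLinear.sl (Fin (2 ^ k)) F) := by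
    rw [finrank_lieAlgebraOf, ncard_RMinus, finrank_sl, ← pow_mul, mul_comm]
  have : Fintype (RMinus F k) := Fintype.ofFinite _
  let u (a : RMinus F k) : lieAlgebraOf hR ξ hξ :=
    ⟨TwistedGroupAlgebra.basis ξ a, Submodule.subset_span ⟨a, a.2, rfl⟩⟩
  -- Orthogonality for the trace form: `tr(ρ a ρ b)` is a multiple of `tr ρ (a + b)`. This vanishes
  -- for distinct roots, whose projections differ, and is nonzero for `a = b` because `2a = 0`.
  have hli : LinearIndependent F fun a : RMinus F k => ρ a := by
    refine LinearMap.BilinForm.linearIndependent_of_iIsOrtho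
      (B := (LinearMap.mul F (Matrix (Fin (2 ^ k)) (Fin (2 ^ k)) F)).compr₂
        (Matrix.traceLinearMap (Fin (2 ^ k)) F F)) (fun a b hab => ?_) fun a h => ?_
    · change (ρ a * ρ b).trace = 0
      rw [hρ, Matrix.trace_smul, htr, smul_zero]
      intro h
      refine hab (Subtype.ext (initHom_injOn_RMinus F k a.2 b.2 ?_))
      rw [map_add] at h
      rw [eq_neg_of_add_eq_zero_left h]
      exact funext fun i => ZMod.neg_eq_self_mod_two _
    · change (ρ a * ρ a).trace = 0 at h
      rw [hρ, show (a : Fin (2 * k + 1) → ZMod 2) + a = 0 from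
        funext fun i => CharTwo.add_self_eq_zero _, Matrix.trace_smul, smul_eq_zero] at h
      exact h.elim (Units.ne_zero _) htr0
  have hliψ : LinearIndependent F fun a : RMinus F k => ψ (u a) := by
    let ι : LieAlgebra.SpecialLinear.sl (Fin (2 ^ k)) F →ₗ[F]
        Matrix (Fin (2 ^ k)) (Fin (2 ^ k)) F :=
      { toFun := Subtype.val
        map_add' := fun _ _ => rfl
        map_smul' := fun _ _ => rfl }
    refine LinearIndependent.of_comp ι ?_
    convert hli using 2 with a
    exact hΦ a
  -- There are as many independent images as the dimension of `sl`, so they span it.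
  have hspan := hliψ.span_eq_top_of_card_eq_finrank' (by
    rw [← hdim, finrank_lieAlgebraOf, ← Nat.card_eq_fintype_card, Nat.card_coe_set_eq])
  have hsurj : Function.Surjective (ψ : lieAlgebraOf hR ξ hξ →ₗ[F]
      LieAlgebra.SpecialLinear.sl (Fin (2 ^ k)) F) := by
    rw [← LinearMap.range_eq_top, ← top_le_iff, ← hspan, Submodule.span_le]
    rintro _ ⟨a, rfl⟩
    exact ⟨u a, rfl⟩
  have : FiniteDimensional F (TwistedGroupAlgebra ξ) :=
    Module.Finite.of_basis (TwistedGroupAlgebra.basis ξ)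
  have : FiniteDimensional F (lieAlgebraOf hR ξ hξ) :=
    inferInstanceAs (FiniteDimensional F (lieAlgebraOf hR ξ hξ).toSubmodule)
  exact ⟨LieEquiv.ofBijective ψ
    ⟨(LinearMap.injective_iff_surjective_of_finrank_eq_finrank hdim).2 hsurj, hsurj⟩⟩

end SkewRoot

theorem mainTheorem7 (F : Type*) [Field F] [IsAlgClosed F] [CharZero F] (k : ℕ) (hk : 2 ≤ k) :
    ∃ hR : SkewRoot.IsLieType (SkewRoot.hBichar F k) (SkewRoot.RMinus F k),
      -- the corresponding reduced system
      SkewRoot.IsLieType (SkewRoot.hBichar F k).quotient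
          (SkewRoot.reducedSet (SkewRoot.hBichar F k) (SkewRoot.RMinus F k)) ∧
        (SkewRoot.hBichar F k).quotient.Nonsingular ∧
        SkewRoot.IsLieType (SkewRoot.stdBichar F k) {a | a ≠ 0} ∧
        (SkewRoot.stdBichar F k).Nonsingular ∧
        (∃ φ : ((Fin (2 * k + 1) → ZMod 2) ⧸ (SkewRoot.hBichar F k).radical) ≃+
            (Fin (2 * k) → ZMod 2),
          (∀ (a : Fin (2 * k + 1) → ZMod 2) (i : Fin (2 * k)),
            φ (QuotientAddGroup.mk a) i = a i.castSucc) ∧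
          SkewRoot.IsSkewIso (SkewRoot.hBichar F k).quotient
            (SkewRoot.reducedSet (SkewRoot.hBichar F k) (SkewRoot.RMinus F k))
            (SkewRoot.stdBichar F k) {a | a ≠ 0} φ) ∧
      -- nonreduced and indecomposable
      ¬ (SkewRoot.hBichar F k).Nonsingular ∧
      ¬ SkewRoot.IsDecomposable (SkewRoot.hBichar F k) (SkewRoot.RMinus F k) ∧
      (SkewRoot.RMinus F k).ncard = 2 ^ (2 * k) - 1 ∧
      -- the Lie algebra, for every choice of a corresponding 2-cocycle
      (∃ ξ : SkewRoot.TwoCocycle (Fin (2 * k + 1) → ZMod 2) F,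
        ξ.Corresponds (SkewRoot.hBichar F k)) ∧
      ∀ (ξ : SkewRoot.TwoCocycle (Fin (2 * k + 1) → ZMod 2) F)
        (hξ : ξ.Corresponds (SkewRoot.hBichar F k)),
        Nonempty (SkewRoot.lieAlgebraOf hR ξ hξ ≃ₗ⁅F⁆
          LieAlgebra.SpecialLinear.sl (Fin (2 ^ k)) F) := by
  have hiso := SkewRoot.reducedEquiv_isSkewIso F k
  have hstd := SkewRoot.stdBichar_isLieType F (k := k) (by omega)
  have hns := SkewRoot.stdBichar_nonsingular F k
  exact ⟨SkewRoot.RMinus_isLieType F hk,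
    hiso.isLieType hstd, hiso.nonsingular hns, hstd, hns,
    ⟨SkewRoot.reducedEquiv F k, fun _ _ => rfl, hiso⟩,
    SkewRoot.hBichar_not_nonsingular F k, SkewRoot.RMinus_not_isDecomposable F k,
    SkewRoot.ncard_RMinus F k,
    ⟨_, SkewRoot.heisenbergCocycle_corresponds F k⟩,
    SkewRoot.nonempty_lieAlgebraOf_equiv_sl _⟩
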